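/- A game is a set $X$ with a relation $\to$ on $X$ such that every $x \in X$ has only finitely many options $x'$ (that is, $x \to x'$) and there is no infinite path $x_0 \to x_1 \to x_2 \to \cdots$. A game morphism $f \colon (X,\to_X) \to (Y,\to_Y)$ is a function $f \colon X \to Y$ such that (1) $x \to_X x'$ implies $f(x) \to_Y f(x')$, and (2) if $f(x) \to_Y y$, then there is $x' \in X$ with $x \to_X x'$ and $f(x') = y$. Let $\mathbf{Game}$ be the category of games and game morphisms, and $U \colon \mathbf{Game} \to \mathbf{Set}$, $(X,\to) \mapsto X$, the forgetful functor. A subgame of a game is a subset that contains every option of each of its members, considered as a game with the restricted relation. For a set $\Lambda$, the $\Lambda$-labeled hereditarily finite sets are defined inductively as the pairs $A = (S,\lambda)$ of a finite set $S$ of $\Lambda$-labeled hereditarily finite sets (the elements of $A$) and a label $\lambda \in \Lambda$; they form a game $\mathbb{H}_\Lambda$ in which the options of $A$ are its elements. An element $A$ of $\mathbb{H}_{\{\top,\bot\}}$ is truth-closed if all its elements are truth-closed and, in case $A$ is labeled by $\top$, all its elements are labeled by $\top$. Let $\Omega$ be the subgame of $\mathbb{H}_{\{\top,\bot\}}$ that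 consists of the truth-closed elements. Theorem. The category $\mathbf{Game}$ has the following properties. (1) $\mathbf{Game}$ is locally finitely presentable, and it has all small limits and all small colimits. A game $(X,\to)$ is a finitely presentable object of $\mathbf{Game}$ if and only if $X$ is finite. (2) The functor $U \colon \mathbf{Game} \to \mathbf{Set}$ is comonadic. It preserves and reflects all small colimits, and strictly creates them: for every small diagram $K$ in $\mathbf{Game}$ and every colimit cocone $c$ under $UK$ in $\mathbf{Set}$, there is exactly one cocone under $K$ whose image under $U$ is equal to $c$, and this cocone is a colimit cocone. (3) The game $\Omega$ is a subobject classifier of $\mathbf{Game}$. The characteristic morphism $\chi_m \colon \mathbb{X} \to \Omega$ of a monomorphism $m \colon \mathbb{S} \to \mathbb{X}$ is such that the label of $\chi_m(x)$ is $\top$ if and only if $x$ lies in the image of $m$. -/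

import Mathlib

open CategoryTheory CategoryTheory.Limits

universe u

/-- An (impartial) game: a set of states with a relation `move x x'` (written `x → x'`) such that
every state has finitely many options and there is no infinite path `x₀ → x₁ → x₂ → ⋯`. -/
structure Game : Type (u + 1) where
  /-- the set of states -/
  carrier : Type u
  /-- the possible moves -/
  move : carrier → carrier → Prop
  finite_options : ∀ x, {x' | move x x'}.Finite
  finite_time : ¬ ∃ p : ℕ → carrier, ∀ n, move (p n) (p (n + 1))

namespace Game

/-- Game morphisms: graph morphisms with the path-lifting property. -/
@[ext]
structure Hom (X Y : Game.{u}) : Type u where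
  /-- the underlying function on states -/
  toFun : X.carrier → Y.carrier
  map_move : ∀ {x x' : X.carrier}, X.move x x' → Y.move (toFun x) (toFun x')
  lift_move : ∀ {x : X.carrier} {y : Y.carrier}, Y.move (toFun x) y →
    ∃ x' : X.carrier, X.move x x' ∧ toFun x' = y

/-- The category of games and game morphisms. -/
instance : Category.{u} Game.{u} where
  Hom := Hom
  id X :=
    { toFun := fun x => x
      map_move := fun h => h
      lift_move := fun {_ y} h => ⟨y, h, rfl⟩ }
  comp f g :=
    { toFun := fun x => g.toFun (f.toFun x)
      map_move := fun h => g.map_move (f.map_move h)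
      lift_move := fun h => by
        obtain ⟨y', hy', rfl⟩ := g.lift_move h
        obtain ⟨x', hx', rfl⟩ := f.lift_move hy'
        exact ⟨x', hx', rfl⟩ }

/-- The forgetful functor `U : Game ⥤ Set`. -/
def U : Game.{u} ⥤ Type u where
  obj X := X.carrier
  map f := TypeCat.ofHom f.toFun

/-- A subgame of `X`: a set of states that contains every option of each of its members. -/
def IsSubgame (X : Game.{u}) (S : Set X.carrier) : Prop :=
  ∀ x x' : X.carrier, x ∈ S → X.move x x' → x' ∈ S

/-- A subgame, regarded as a game with the moves of the ambient game. -/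
def ofSubgame (X : Game.{u}) (S : Set X.carrier) (_hS : X.IsSubgame S) : Game.{u} where
  carrier := S
  move x x' := X.move x.1 x'.1
  finite_options x := (X.finite_options x.1).preimage Subtype.val_injective.injOn
  finite_time := fun ⟨p, hp⟩ => X.finite_time ⟨fun n => (p n).1, hp⟩

end Game

/-- The functor `X ↦ 𝒫_fin(X) × Λ`. -/
def LabeledPfin (Λ : Type u) (X : Type u) : Type u := {S : Set X // S.Finite} × Λ

/-- `𝒫_fin(-) × Λ` acts on functions by direct image; it is a quotient of the polynomial functor
`X ↦ ∑ n, Xⁿ × Λ`, a finite sequence representing the finite set of its entries. -/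
noncomputable instance (Λ : Type u) : QPF (LabeledPfin Λ) where
  map f x := (⟨f '' x.1.1, x.1.2.image f⟩, x.2)
  P := { A := ℕ × Λ, B := fun a => ULift.{u} (Fin a.1) }
  abs p := (⟨Set.range p.2, Set.finite_range p.2⟩, p.1.2)
  repr x := ⟨(x.1.2.toFinset.card, x.2),
    fun i => (x.1.2.toFinset.equivFin.symm i.down).1⟩
  abs_repr := by
    rintro α ⟨⟨S, hS⟩, l⟩
    refine Prod.ext (Subtype.ext (Set.ext fun y => ⟨?_, fun hy => ?_⟩)) rfl
    · rintro ⟨i, rfl⟩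
      exact hS.mem_toFinset.1 (hS.toFinset.equivFin.symm i.down).2
    · exact ⟨⟨hS.toFinset.equivFin ⟨y, hS.mem_toFinset.2 hy⟩⟩, by simp⟩
  abs_map := by
    rintro α β f ⟨a, g⟩
    exact Prod.ext (Subtype.ext (Set.range_comp f g)) rfl

/-- `Λ`-labeled hereditarily finite sets: the inductive type whose elements are the pairs `(S, l)`
of a finite set `S` of `Λ`-labeled hereditarily finite sets and a label `l : Λ`, i.e. the initial
algebra of `𝒫_fin(-) × Λ`. -/
def LabeledHFSet (Λ : Type u) : Type u := QPF.Fix (LabeledPfin Λ)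

namespace LabeledHFSet

variable {Λ : Type u}

/-- The labeled hereditarily finite set `(S, l)`. -/
noncomputable def mk (S : Set (LabeledHFSet Λ)) (hS : S.Finite) (l : Λ) : LabeledHFSet Λ :=
  QPF.Fix.mk (F := LabeledPfin Λ) (⟨S, hS⟩, l)

/-- The set `S` of elements of `(S, l)`. -/
noncomputable def elements (A : LabeledHFSet Λ) : Set (LabeledHFSet Λ) :=
  (QPF.Fix.dest (F := LabeledPfin Λ) A).1.1

/-- The label `l` of `(S, l)`. -/
noncomputable def label (A : LabeledHFSet Λ) : Λ :=
  (QPF.Fix.dest (F := LabeledPfin Λ) A).2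

theorem finite_elements (A : LabeledHFSet Λ) : A.elements.Finite :=
  (QPF.Fix.dest (F := LabeledPfin Λ) A).1.2

@[simp]
theorem elements_mk (S : Set (LabeledHFSet Λ)) (hS : S.Finite) (l : Λ) :
    (mk S hS l).elements = S :=
  congrArg (fun x : LabeledPfin Λ (LabeledHFSet Λ) => x.1.1)
    (QPF.Fix.dest_mk (F := LabeledPfin Λ) (⟨S, hS⟩, l))

@[simp]
theorem label_mk (S : Set (LabeledHFSet Λ)) (hS : S.Finite) (l : Λ) :
    (mk S hS l).label = l :=
  congrArg (fun x : LabeledPfin Λ (LabeledHFSet Λ) => x.2)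
    (QPF.Fix.dest_mk (F := LabeledPfin Λ) (⟨S, hS⟩, l))

@[simp]
theorem mk_elements_label (A : LabeledHFSet Λ) :
    mk A.elements A.finite_elements A.label = A :=
  QPF.Fix.mk_dest (F := LabeledPfin Λ) A

/-- Induction along the membership relation. -/
theorem induction {p : LabeledHFSet Λ → Prop}
    (h : ∀ A : LabeledHFSet Λ, (∀ B ∈ A.elements, p B) → p A) :
    ∀ A : LabeledHFSet Λ, p A := by
  refine QPF.Fix.ind (F := LabeledPfin Λ) p ?_
  rintro _ ⟨⟨⟨S, hS⟩, l⟩, rfl⟩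
  refine h _ fun B hB => ?_
  unfold elements at hB
  rw [QPF.Fix.dest_mk] at hB
  obtain ⟨C, _, rfl⟩ := hB
  exact C.2

/-- The cofree game on `Λ`: its states are the `Λ`-labeled hereditarily finite sets, and the
options of `(S, l)` are the elements of `S`. -/
noncomputable def game (Λ : Type u) : Game.{u} where
  carrier := LabeledHFSet Λ
  move A B := B ∈ A.elements
  finite_options A := A.finite_elements
  finite_time := by
    have key : ∀ A : LabeledHFSet Λ,
        ∀ p : ℕ → LabeledHFSet Λ, p 0 = A → ¬ ∀ n, p (n + 1) ∈ (p n).elements := by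
      refine induction fun A ih => ?_
      rintro p rfl hp
      exact ih (p 1) (hp 0) (fun n => p (n + 1)) rfl fun n => hp (n + 1)
    rintro ⟨p, hp⟩
    exact key _ p rfl hp

end LabeledHFSet

/-- The two-element set `{⊤, ⊥}` of truth values. -/
inductive TruthValue : Type u
  | top
  | bot

/-- A `{⊤, ⊥}`-labeled hereditarily finite set `A` is truth-closed if all its elements are labeled
by `⊤` when `A` itself is, and all its elements are truth-closed. -/
inductive TruthClosed : LabeledHFSet TruthValue.{u} → Prop
  | intro (A : LabeledHFSet TruthValue.{u})
      (label_top : A.label = TruthValue.top → ∀ B ∈ A.elements, B.label = TruthValue.top)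
      (elements_closed : ∀ B ∈ A.elements, TruthClosed B) : TruthClosed A

theorem isSubgame_truthClosed :
    (LabeledHFSet.game TruthValue.{u}).IsSubgame {A | TruthClosed A} := by
  rintro _ B ⟨A, _, h⟩ hB
  exact h B hB

/-- The game `Ω`: the subgame of truth-closed `{⊤, ⊥}`-labeled hereditarily finite sets. -/
noncomputable def Game.omega : Game.{u} :=
  (LabeledHFSet.game TruthValue.{u}).ofSubgame {A | TruthClosed A} isSubgame_truthClosed

/-- The label in `{⊤, ⊥}` of a state of `Ω`. -/
noncomputable def Game.omegaLabel (A : Game.omega.{u}.carrier) : TruthValue.{u} :=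
  LabeledHFSet.label A.1

/-- `F` strictly creates small colimits: each colimit cocone `c` under `K ⋙ F` is the image, on the
nose, of exactly one cocone under `K`, and that cocone is a colimit cocone. -/
def StrictlyCreatesColimits {C : Type (u + 1)} [Category.{u} C] (F : C ⥤ Type u) : Prop :=
  ∀ (J : Type u) [SmallCategory J] (K : J ⥤ C) (c : Cocone (K ⋙ F)), IsColimit c →
    (∃! d : Cocone K, F.mapCocone d = c) ∧
      ∀ d : Cocone K, F.mapCocone d = c → Nonempty (IsColimit d)

/-!
A game is a coalgebra for the finite powerset functor whose move relation is well founded, and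
everything below rests on one computation: a game morphism `f` maps the options of `x` onto the
options of `f x` (`Game.options_toFun`).

*Colimits.* By this computation, sending a state to the image of its set of options is compatible
with the maps of a diagram, so it descends to a colimit of the sets of states
(`Game.colimitOptions`). The resulting move relation is the only one that makes the cocone a cocone
of games, and paths lift along the cocone, so `U` strictly creates colimits.

*Comonadicity and limits.* By recursion along the moves, every labeling `X → Λ` of the states
extends uniquely to a morphism from `X` to the game of `Λ`-labeled hereditarily finite sets
(`Game.unfoldHom`, `Game.hom_ext_label`); this is the right adjoint of `U`. The limit of a diagram
consists of the hereditarily finite sets labeled by compatible families of states such that all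
components of the label are morphisms (`Game.limitCone`). The set-theoretic equalizer of a
coreflexive pair of morphisms is already a subgame (`Game.isSubgame_eqLocus`), so `U` preserves
coreflexive equalizers; as it reflects isomorphisms, the crude comonadicity theorem applies.

*Finite presentability.* A function from a finite game to a stage of a filtered diagram that
represents a morphism to the colimit becomes a morphism at a later stage, since only finitely many
identifications are needed (`Game.exists_hom_of_isColimit`). Hence finite games are finitely
presentable. By well-founded induction every state lies in a finite subgame, so each game is the
directed union of its finite subgames. So finite games generate, and a finitely presentable game is
a retract of a finite one.

*Subobject classifier.* Monomorphisms are injective, because the set-theoretic kernel pair carries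
a game structure (`Game.injective_of_mono`). The image of a monomorphism is a subgame, and the
unfolding of its membership labeling is truth-closed; this is the characteristic morphism. It is
unique since morphisms to `Ω` are determined by labels.
-/

/-! ### Game morphisms -/

namespace Game

variable {X Y Z : Game.{u}}

@[simp]
theorem comp_toFun (f : X ⟶ Y) (g : Y ⟶ Z) (x : X.carrier) :
    (f ≫ g).toFun x = g.toFun (f.toFun x) := rfl

theorem hom_ext {f g : X ⟶ Y} (h : ∀ x, f.toFun x = g.toFun x) : f = g :=
  Hom.ext (funext h)

theorem congr_toFun {f g : X ⟶ Y} (h : f = g) (x : X.carrier) : f.toFun x = g.toFun x := by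
  rw [h]

instance : U.{u}.Faithful where
  map_injective h := hom_ext fun x => types_congr_hom h x

theorem wellFounded_move (X : Game.{u}) : WellFounded fun x' x => X.move x x' :=
  wellFounded_iff_isEmpty_descending_chain.2 ⟨fun p => X.finite_time ⟨p.1, p.2⟩⟩

/-- Induction along the options: a property of states holds everywhere as soon as it passes from
the options of a state to the state. -/
theorem move_induction (X : Game.{u}) {p : X.carrier → Prop}
    (h : ∀ x, (∀ x', X.move x x' → p x') → p x) (x : X.carrier) : p x :=
  X.wellFounded_move.induction x h

/-- The options of `f x` are the images of the options of `x`. -/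
theorem options_toFun (f : X ⟶ Y) (x : X.carrier) :
    {y | Y.move (f.toFun x) y} = f.toFun '' {x' | X.move x x'} := by
  ext y
  constructor
  · exact fun h => f.lift_move h
  · rintro ⟨x', hx', rfl⟩
    exact f.map_move hx'

/-! ### Subgames -/

/-- The inclusion of a subgame. -/
def subgameι (X : Game.{u}) (S : Set X.carrier) (hS : X.IsSubgame S) : X.ofSubgame S hS ⟶ X where
  toFun x := x.1
  map_move h := h
  lift_move {x y} h := ⟨⟨y, hS _ _ x.2 h⟩, h, rfl⟩

/-- A morphism with values in a subgame, regarded as a morphism to that subgame. -/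
def subgameLift {S : Set X.carrier} (hS : X.IsSubgame S) (f : Z ⟶ X) (hf : ∀ z, f.toFun z ∈ S) :
    Z ⟶ X.ofSubgame S hS where
  toFun z := ⟨f.toFun z, hf z⟩
  map_move h := f.map_move h
  lift_move {z y} h := by
    obtain ⟨z', hz', e⟩ := f.lift_move h
    exact ⟨z', hz', Subtype.ext e⟩

theorem isSubgame_range (f : X ⟶ Y) : Y.IsSubgame (Set.range f.toFun) := by
  rintro _ y ⟨x, rfl⟩ h
  obtain ⟨x', -, rfl⟩ := f.lift_move h
  exact ⟨x', rfl⟩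

/-! ### Isomorphisms -/

/-- A bijective morphism is an isomorphism. -/
theorem isIso_of_bijective (f : X ⟶ Y) (hf : Function.Bijective f.toFun) : IsIso f := by
  obtain ⟨g, hl, hr⟩ := Function.bijective_iff_has_inverse.1 hf
  let g' : Y ⟶ X :=
    { toFun := g
      map_move := fun {y y'} h => by
        obtain ⟨x, hx, rfl⟩ := f.lift_move (x := g y) (y := y') (by rwa [hr y])
        rwa [hl x]
      lift_move := fun {y x} h => ⟨f.toFun x, by simpa [hr y] using f.map_move h, hl x⟩ }
  exact ⟨g', hom_ext hl, hom_ext hr⟩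

instance : U.{u}.ReflectsIsomorphisms where
  reflects f hf := isIso_of_bijective f ((isIso_iff_bijective _).1 hf)

end Game

/-! ### Cofree games -/

namespace LabeledHFSet

variable {Λ : Type u}

theorem ext {A B : LabeledHFSet Λ} (h : A.elements = B.elements) (h' : A.label = B.label) :
    A = B := by
  rw [← mk_elements_label A, ← mk_elements_label B]
  congr

end LabeledHFSet

namespace Game

variable {X Y : Game.{u}} {Λ : Type u}

/-- The labeled hereditarily finite set unfolding a state `x` of a game with a labeling `f` of its
states: its label is `f x`, and its elements are the unfoldings of the options of `x`. -/
noncomputable def unfold (X : Game.{u}) (f : X.carrier → Λ) : X.carrier → LabeledHFSet Λ :=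
  X.wellFounded_move.fix fun x ih =>
    LabeledHFSet.mk (Set.range fun x' : {x' | X.move x x'} => ih x'.1 x'.2)
      (have := (X.finite_options x).to_subtype; Set.finite_range _) (f x)

theorem unfold_eq (f : X.carrier → Λ) (x : X.carrier) :
    X.unfold f x = LabeledHFSet.mk (X.unfold f '' {x' | X.move x x'})
      ((X.finite_options x).image _) (f x) := by
  rw [unfold, WellFounded.fix_eq]
  congr 1
  exact Set.image_eq_range _ _ |>.symm

@[simp]
theorem elements_unfold (f : X.carrier → Λ) (x : X.carrier) :
    (X.unfold f x).elements = X.unfold f '' {x' | X.move x x'} := by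
  rw [unfold_eq, LabeledHFSet.elements_mk]

@[simp]
theorem label_unfold (f : X.carrier → Λ) (x : X.carrier) : (X.unfold f x).label = f x := by
  rw [unfold_eq, LabeledHFSet.label_mk]

/-- The morphism to the cofree game induced by a labeling of the states. -/
noncomputable def unfoldHom (X : Game.{u}) (f : X.carrier → Λ) : X ⟶ LabeledHFSet.game Λ where
  toFun := X.unfold f
  map_move {x x'} h := by
    change _ ∈ LabeledHFSet.elements _
    rw [elements_unfold]
    exact ⟨x', h, rfl⟩
  lift_move {x y} h := by
    change _ ∈ LabeledHFSet.elements _ at h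
    rwa [elements_unfold] at h

/-- A morphism to a cofree game is determined by the labels of its values. -/
theorem hom_ext_label {g g' : X ⟶ LabeledHFSet.game Λ}
    (h : ∀ x, LabeledHFSet.label (g.toFun x) = LabeledHFSet.label (g'.toFun x)) : g = g' := by
  refine hom_ext (X.move_induction fun x ih => LabeledHFSet.ext ?_ (h x))
  exact (options_toFun g x).trans ((Set.image_congr ih).trans (options_toFun g' x).symm)

/-- Morphisms to the cofree game on `Λ` are the same as labelings of the states by `Λ`. -/
noncomputable def cofreeHomEquiv (X : Game.{u}) (Λ : Type u) :
    (U.obj X ⟶ Λ) ≃ (X ⟶ LabeledHFSet.game Λ) where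
  toFun f := X.unfoldHom f
  invFun g := TypeCat.ofHom fun x => LabeledHFSet.label (g.toFun x)
  left_inv f := by
    ext x
    exact label_unfold _ x
  right_inv g := hom_ext_label fun x => label_unfold _ x

/-- The cofree game functor, right adjoint to the forgetful functor. -/
noncomputable def cofree : Type u ⥤ Game.{u} :=
  Adjunction.rightAdjointOfEquiv (F := U) cofreeHomEquiv
    fun _ _ _ _ _ => hom_ext_label fun _ => by
      refine (label_unfold _ _).trans (.symm ?_)
      exact label_unfold _ _

/-- The forgetful functor is left adjoint to the cofree game functor. -/
noncomputable def adjunction : U.{u} ⊣ cofree :=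
  Adjunction.adjunctionOfEquivRight _ _

instance : PreservesColimitsOfSize.{u, u} U.{u} := adjunction.leftAdjoint_preservesColimits

/-! ### Colimits -/

section Colimits

variable {J : Type u} [SmallCategory J] {K : J ⥤ Game.{u}}

theorem exists_ι_eq {c : Cocone (K ⋙ U)} (hc : IsColimit c) (y : c.pt) :
    ∃ (j : J) (x : (K.obj j).carrier), c.ι.app j x = y :=
  Types.jointly_surjective_of_isColimit hc y

/-- For a colimit cocone in `Set` under the states of a diagram of games: the map that sends a
point represented by a state `x` to the set of points represented by the options of `x`. It is
obtained from the universal property, since game morphisms map options onto options. -/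
noncomputable def colimitOptions {c : Cocone (K ⋙ U)} (hc : IsColimit c) : c.pt → Set c.pt :=
  hc.desc
    { pt := Set c.pt
      ι :=
        { app := fun j => TypeCat.ofHom fun x : (K.obj j).carrier =>
            c.ι.app j '' {x' | (K.obj j).move x x'}
          naturality := fun i j f => by
            refine ConcreteCategory.hom_ext _ _ fun (x : (K.obj i).carrier) => ?_
            refine (congrArg (c.ι.app j '' ·) (options_toFun (K.map f) x)).trans ?_
            refine (Set.image_image _ _ _).trans ?_
            exact Set.image_congr fun x' _ => types_congr_hom (c.w f) x' } }

theorem colimitOptions_ι {c : Cocone (K ⋙ U)} (hc : IsColimit c) (j : J)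
    (x : (K.obj j).carrier) :
    colimitOptions hc (c.ι.app j x) = c.ι.app j '' {x' | (K.obj j).move x x'} :=
  types_congr_hom (hc.fac _ j) x

/-- The game structure on a colimit, in `Set`, of the states of a diagram of games. -/
noncomputable def colimitGame {c : Cocone (K ⋙ U)} (hc : IsColimit c) : Game.{u} where
  carrier := c.pt
  move y y' := y' ∈ colimitOptions hc y
  finite_options y := by
    obtain ⟨j, x, rfl⟩ := exists_ι_eq hc y
    change (colimitOptions hc _).Finite
    rw [colimitOptions_ι]
    exact ((K.obj j).finite_options x).image _
  finite_time := by
    -- A path starting at the image of a state of `K j` lifts to a path in `K j`.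
    have key : ∀ (j : J) (x : (K.obj j).carrier) (p : ℕ → c.pt), p 0 = c.ι.app j x →
        ¬ ∀ n, p (n + 1) ∈ colimitOptions hc (p n) := by
      intro j x
      induction x using move_induction with
      | h x ih =>
        intro p h0 hp
        have h1 := hp 0
        rw [h0, colimitOptions_ι] at h1
        obtain ⟨x', hx', e⟩ := h1
        exact ih x' hx' (fun n => p (n + 1)) e.symm fun n => hp (n + 1)
    rintro ⟨p, hp⟩
    obtain ⟨j, x, h⟩ := exists_ι_eq hc (p 0)
    exact key j x p h.symm hp

/-- The cocone of games that lifts a colimit cocone in `Set`. -/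
noncomputable def colimitCocone {c : Cocone (K ⋙ U)} (hc : IsColimit c) : Cocone K where
  pt := colimitGame hc
  ι :=
    { app := fun j =>
        { toFun := c.ι.app j
          map_move := fun {x x'} h => by
            change _ ∈ colimitOptions hc _
            rw [colimitOptions_ι]
            exact ⟨x', h, rfl⟩
          lift_move := fun {x y} h => by
            change _ ∈ colimitOptions hc _ at h
            rwa [colimitOptions_ι] at h }
      naturality := fun _ _ f => hom_ext fun x => types_congr_hom (c.w f) x }

/-- A cocone of games is determined by its image in `Set` when the latter is a colimit: the
moves on its vertex have to be the images of moves in the diagram. -/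
theorem cocone_eq_of_mapCocone_eq {d d' : Cocone K} (h : U.mapCocone d = U.mapCocone d')
    (hd : IsColimit (U.mapCocone d')) : d = d' := by
  obtain ⟨⟨C, m, hf, ht⟩, ι⟩ := d
  obtain ⟨⟨C', m', hf', ht'⟩, ι'⟩ := d'
  simp only [Functor.mapCocone, Cocone.mk.injEq, Cocone.functoriality] at h
  obtain ⟨h1, h2⟩ := h
  change C = C' at h1
  subst h1
  have h3 : ∀ (j : J) (x : (K.obj j).carrier), (ι.app j).toFun x = (ι'.app j).toFun x :=
    fun j x => types_congr_hom (congr_app (eq_of_heq h2) j) x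
  have h4 : m = m' := by
    ext y z
    obtain ⟨j, x, rfl⟩ := exists_ι_eq hd y
    have e := options_toFun (ι.app j) x
    have e' := options_toFun (ι'.app j) x
    rw [Set.image_congr fun x' _ => h3 j x', ← e'] at e
    refine Iff.trans (iff_of_eq (congrArg (m · z) (h3 j x).symm)) (Set.ext_iff.1 e z)
  subst h4
  congr 1
  ext j : 2
  exact hom_ext (h3 j)

theorem mapCocone_colimitCocone {c : Cocone (K ⋙ U)} (hc : IsColimit c) :
    U.mapCocone (colimitCocone hc) = c := rfl

/-- A cocone of games whose image in `Set` is a colimit is a colimit. -/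
noncomputable def isColimitOfMapCocone {d : Cocone K} (hd : IsColimit (U.mapCocone d)) :
    IsColimit d where
  desc s :=
    { toFun := hd.desc (U.mapCocone s)
      map_move := fun {y y'} h => by
        obtain ⟨j, x, rfl⟩ := exists_ι_eq hd y
        obtain ⟨x', hx', rfl⟩ := (d.ι.app j).lift_move h
        have e := types_congr_hom (hd.fac (U.mapCocone s) j)
        exact (congrArg₂ s.pt.move (e x) (e x')).mpr ((s.ι.app j).map_move hx')
      lift_move := fun {y z} h => by
        obtain ⟨j, x, rfl⟩ := exists_ι_eq hd y
        have e := types_congr_hom (hd.fac (U.mapCocone s) j)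
        obtain ⟨x', hx', rfl⟩ :=
          (s.ι.app j).lift_move ((congrArg (s.pt.move · z) (e x)).mp h)
        exact ⟨_, (d.ι.app j).map_move hx', e x'⟩ }
  fac s j := hom_ext fun x => types_congr_hom (hd.fac (U.mapCocone s) j) x
  uniq s m hm := U.map_injective
    (hd.uniq (U.mapCocone s) (U.map m) fun j => congrArg U.map (hm j))

end Colimits

theorem strictlyCreatesColimits_U : StrictlyCreatesColimits U.{u} := by
  intro J _ K c hc
  refine ⟨⟨colimitCocone hc, mapCocone_colimitCocone hc, fun d hd =>
    cocone_eq_of_mapCocone_eq hd hc⟩, ?_⟩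
  rintro d rfl
  exact ⟨isColimitOfMapCocone hc⟩

instance : HasColimitsOfSize.{u, u} Game.{u} where
  has_colimits_of_shape _ _ :=
    { has_colimit := fun K =>
        ⟨_, isColimitOfMapCocone (d := colimitCocone (colimit.isColimit (K ⋙ U)))
          (colimit.isColimit (K ⋙ U))⟩ }

instance : ReflectsColimitsOfSize.{u, u} U.{u} where
  reflectsColimitsOfShape := { reflectsColimit := { reflects := fun h => ⟨isColimitOfMapCocone h⟩ } }

/-! ### Limits -/

section Limits

variable {J : Type u} [SmallCategory J] (K : J ⥤ Game.{u})

/-- A hereditarily finite set labeled by compatible families of states of the games `K j` is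
coherent if, hereditarily and for every `j`, the `j`-th components of the labels of its elements
are exactly the options of the `j`-th component of its own label. -/
inductive IsCoherent : LabeledHFSet (K ⋙ U).sections → Prop
  | intro (A : LabeledHFSet (K ⋙ U).sections)
      (map_move : ∀ B ∈ A.elements, ∀ j, (K.obj j).move (A.label.1 j) (B.label.1 j))
      (lift_move : ∀ j y, (K.obj j).move (A.label.1 j) y → ∃ B ∈ A.elements, B.label.1 j = y)
      (elements_coherent : ∀ B ∈ A.elements, IsCoherent B) : IsCoherent A

theorem isSubgame_isCoherent :
    (LabeledHFSet.game (K ⋙ U).sections).IsSubgame {A | IsCoherent K A} := by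
  rintro _ B ⟨A, _, _, h⟩ hB
  exact h B hB

/-- The limit cone of a diagram of games. Its vertex is the largest subgame of the cofree game on
the limit of the sets of states on which the components of the label are morphisms. -/
noncomputable def limitCone : Cone K where
  pt := (LabeledHFSet.game (K ⋙ U).sections).ofSubgame {A | IsCoherent K A}
    (isSubgame_isCoherent K)
  π :=
    { app := fun j =>
        { toFun := fun A => (LabeledHFSet.label A.1).1 j
          map_move := by
            rintro ⟨_, ⟨A, h, _, _⟩⟩ ⟨B, _⟩ hB
            exact h B hB j
          lift_move := by
            rintro ⟨_, ⟨A, _, h, h'⟩⟩ y hy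
            obtain ⟨B, hB, e⟩ := h j y hy
            exact ⟨⟨B, h' B hB⟩, hB, e⟩ }
      naturality := fun _ _ f => hom_ext fun A => ((LabeledHFSet.label A.1).2 f).symm }

variable {K}

/-- The labeling of the vertex of a cone of games by compatible families of states. -/
def sectionLabel (s : Cone K) (x : s.pt.carrier) : (K ⋙ U).sections :=
  ⟨fun j => (s.π.app j).toFun x, fun f => congr_toFun (s.w f) x⟩

theorem isCoherent_unfold (s : Cone K) (x : s.pt.carrier) :
    IsCoherent K (s.pt.unfold (sectionLabel s) x) := by
  induction x using move_induction with
  | h x ih =>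
    refine .intro _ ?_ ?_ ?_ <;> simp only [elements_unfold, label_unfold]
    · rintro _ ⟨x', hx', rfl⟩ j
      rw [label_unfold]
      exact (s.π.app j).map_move hx'
    · intro j y hy
      obtain ⟨x', hx', rfl⟩ := (s.π.app j).lift_move hy
      exact ⟨_, ⟨x', hx', rfl⟩, by rw [label_unfold]; rfl⟩
    · rintro _ ⟨x', hx', rfl⟩
      exact ih x' hx'

variable (K) in
/-- The cone `limitCone K` is a limit. -/
noncomputable def limitConeIsLimit : IsLimit (limitCone K) where
  lift s := subgameLift (isSubgame_isCoherent K) (s.pt.unfoldHom (sectionLabel s))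
    (isCoherent_unfold s)
  fac s j := hom_ext fun x =>
    congrArg (fun l : (K ⋙ U).sections => l.1 j) (label_unfold (sectionLabel s) x)
  uniq s m hm := by
    refine hom_ext fun x => Subtype.ext ?_
    refine congr_toFun (f := m ≫ subgameι _ _ (isSubgame_isCoherent K))
      (g := s.pt.unfoldHom (sectionLabel s)) (hom_ext_label fun x => Subtype.ext ?_) x
    refine (funext fun j => congr_toFun (hm j) x).trans ?_
    exact (congrArg Subtype.val (label_unfold (sectionLabel s) x)).symm

end Limits

instance : HasLimitsOfSize.{u, u} Game.{u} where
  has_limits_of_shape _ _ := { has_limit := fun K => ⟨_, limitConeIsLimit K⟩ }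

/-! ### Comonadicity -/

section Comonadic

variable {X Y : Game.{u}}

/-- The set-theoretic equalizer of a coreflexive pair of game morphisms is a subgame: if
`f x = g x` and `x → x'`, then `f x'` is an option of `g x`, so `f x' = g x''` for an option `x''`
of `x`, and a common retraction of `f` and `g` gives `x' = x''`. -/
theorem isSubgame_eqLocus (f g : X ⟶ Y) [IsCoreflexivePair f g] :
    X.IsSubgame {x | f.toFun x = g.toFun x} := by
  intro x x' hx h
  obtain ⟨r, hf, hg⟩ := IsCoreflexivePair.common_retraction f g
  have h1 := f.map_move h
  rw [show f.toFun x = g.toFun x from hx] at h1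
  obtain ⟨x'', -, e⟩ := g.lift_move h1
  have : x'' = x' := by
    have e' := congrArg r.toFun e
    rwa [← comp_toFun, ← comp_toFun, hf, hg] at e'
  subst this
  exact e.symm

/-- The inclusion of the set-theoretic equalizer of a coreflexive pair, as a fork. -/
def eqLocusFork (f g : X ⟶ Y) [IsCoreflexivePair f g] : Fork f g :=
  Fork.ofι (subgameι X _ (isSubgame_eqLocus f g)) (hom_ext fun x => x.2)

/-- The set-theoretic equalizer of a coreflexive pair is an equalizer of games. -/
def eqLocusForkIsLimit (f g : X ⟶ Y) [IsCoreflexivePair f g] : IsLimit (eqLocusFork f g) :=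
  Fork.IsLimit.mk _
    (fun s => subgameLift (isSubgame_eqLocus f g) s.ι (congr_toFun s.condition))
    (fun _ => rfl)
    (fun _ _ h => hom_ext fun x => Subtype.ext (congr_toFun h x))

instance : Comonad.PreservesLimitOfIsCoreflexivePair U.{u} where
  out _ _ f g _ := preservesLimit_of_preserves_limit_cone (eqLocusForkIsLimit f g) <|
    (isLimitMapConeForkEquiv U _).symm <| Nonempty.some <|
      (Types.type_equalizer_iff_unique _ _).2 fun y hy =>
        ⟨⟨y, hy⟩, rfl, fun _ h => Subtype.ext h⟩

noncomputable instance : ComonadicLeftAdjoint U.{u} :=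
  Comonad.comonadicOfHasPreservesCoreflexiveEqualizersOfReflectsIsomorphisms adjunction

end Comonadic

/-! ### Finite games are finitely presentable -/

section FinitelyPresentable

attribute [local instance] Cardinal.fact_isRegular_aleph0

theorem isFinitelyPresentable_type (T : Type u) [Finite T] : IsFinitelyPresentable.{u} T :=
  HasCardinalLT.isCardinalPresentable (hasCardinalLT_aleph0_iff T |>.2 inferInstance)

variable {J : Type u} [SmallCategory J] [IsFiltered J] {K : J ⥤ Game.{u}} {c : Cocone K}

/-- Finitely many states of a game in a filtered diagram that are pairwise identified in the
colimit are identified at a later stage of the diagram. -/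
theorem exists_map_eq_of_isColimit (hc : IsColimit c) {T : Type u} [Finite T] {j : J}
    (a b : T → (K.obj j).carrier) (h : ∀ t, (c.ι.app j).toFun (a t) = (c.ι.app j).toFun (b t)) :
    ∃ (k : J) (u : j ⟶ k), ∀ t, (K.map u).toFun (a t) = (K.map u).toFun (b t) := by
  have := isFinitelyPresentable_type T
  obtain ⟨k, u, v, e⟩ := IsFinitelyPresentable.exists_eq_of_isColimit
    (isColimitOfPreserves U hc) (X := T) (i := j) (j := j) (TypeCat.ofHom a) (TypeCat.ofHom b)
    (ConcreteCategory.hom_ext _ _ h)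
  refine ⟨IsFiltered.coeq u v, u ≫ IsFiltered.coeqHom u v, fun t => ?_⟩
  have e' : (K.map u).toFun (a t) = (K.map v).toFun (b t) := types_congr_hom e t
  conv_rhs => rw [IsFiltered.coeq_condition]
  rw [K.map_comp, K.map_comp, comp_toFun, comp_toFun, e']

/-- A morphism from a finite game to a filtered colimit factors through the diagram. A function
`g` that factors it at some stage exists since the game is finite. Up to identification in the
colimit the options of `g x` are the values of `g` at the options of `x`; there are finitely many
of these identifications, so they hold at a later stage, where `g` becomes a morphism. -/
theorem exists_hom_of_isColimit (hc : IsColimit c) {X : Game.{u}} [Finite X.carrier]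
    (f : X ⟶ c.pt) : ∃ (j : J) (g : X ⟶ K.obj j), g ≫ c.ι.app j = f := by
  have := isFinitelyPresentable_type X.carrier
  obtain ⟨j, g, hg⟩ : ∃ (j : J) (g : X.carrier → (K.obj j).carrier),
      ∀ x, (c.ι.app j).toFun (g x) = f.toFun x := by
    obtain ⟨j, p, hp⟩ := IsFinitelyPresentable.exists_hom_of_isColimit
      (isColimitOfPreserves U hc) (X := X.carrier) (U.map f)
    exact ⟨j, p, types_congr_hom hp⟩
  -- The finitely many pairs of an option `y` of some `g x` and a state `x'` such that `y` and `g x'`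
  -- represent the same point of the colimit.
  let T : Set ((Σ x : X.carrier, {y | (K.obj j).move (g x) y}) × X.carrier) :=
    {p | (c.ι.app j).toFun p.1.2.1 = f.toFun p.2}
  have (x : X.carrier) : Finite {y | (K.obj j).move (g x) y} :=
    ((K.obj j).finite_options _).to_subtype
  obtain ⟨k, u, hu⟩ := exists_map_eq_of_isColimit hc (T := T) (fun p => p.1.1.2.1)
    (fun p => g p.1.2) (fun p => p.2.trans (hg _).symm)
  have hu' : ∀ {x x' y}, (K.obj j).move (g x) y → (c.ι.app j).toFun y = f.toFun x' →
      (K.map u).toFun y = (K.map u).toFun (g x') :=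
    fun {x x' y} h h' => hu ⟨⟨⟨x, ⟨y, h⟩⟩, x'⟩, h'⟩
  refine ⟨k, { toFun := fun x => (K.map u).toFun (g x), map_move := ?_, lift_move := ?_ }, ?_⟩
  · intro x x' h
    have h1 := f.map_move h
    rw [← hg] at h1
    obtain ⟨y, hy, e⟩ := (c.ι.app j).lift_move h1
    rw [← hu' hy e]
    exact (K.map u).map_move hy
  · intro x z h
    obtain ⟨y, hy, rfl⟩ := (K.map u).lift_move h
    have h1 := (c.ι.app j).map_move hy
    rw [hg] at h1
    obtain ⟨x', hx', e⟩ := f.lift_move h1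
    exact ⟨x', hx', (hu' hy e.symm).symm⟩
  · exact hom_ext fun x => (congr_toFun (c.w u) (g x)).trans (hg x)

theorem isFinitelyPresentable_of_finite (X : Game.{u}) [Finite X.carrier] :
    IsFinitelyPresentable.{u} X := by
  rw [isFinitelyPresentable_iff_preservesFilteredColimitsOfSize]
  refine ⟨fun J _ _ => ⟨fun {K} => ⟨fun {c} hc => ⟨?_⟩⟩⟩⟩
  refine Types.FilteredColimit.isColimitOf' _ _ (fun f => ?_) (fun j f g h => ?_)
  · obtain ⟨j, g, hg⟩ := exists_hom_of_isColimit hc (X := X) f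
    exact ⟨j, g, hg.symm⟩
  · obtain ⟨k, u, hu⟩ := exists_map_eq_of_isColimit hc (T := X.carrier) (j := j)
      (Hom.toFun f) (Hom.toFun g) (congr_toFun (X := X) (Y := c.pt) h)
    exact ⟨k, u, hom_ext hu⟩

end FinitelyPresentable

/-! ### Every game is the directed union of its finite subgames -/

section FiniteSubgames

variable (X : Game.{u})

/-- Every state lies in a finite subgame, by induction along its finitely many options. -/
theorem exists_finite_subgame (x : X.carrier) :
    ∃ S : Set X.carrier, X.IsSubgame S ∧ S.Finite ∧ x ∈ S := by
  induction x using move_induction with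
  | h x ih =>
    choose S hS hf hm using ih
    have := (X.finite_options x).to_subtype
    refine ⟨insert x (⋃ x' : {x' | X.move x x'}, S x'.1 x'.2), ?_,
      (Set.finite_iUnion fun y : {x' | X.move x x'} => hf y.1 y.2).insert x, Set.mem_insert _ _⟩
    rintro y z (rfl | hy) h
    · exact .inr (Set.mem_iUnion.2 ⟨⟨z, h⟩, hm z h⟩)
    · obtain ⟨x', hx'⟩ := Set.mem_iUnion.1 hy
      exact .inr (Set.mem_iUnion.2 ⟨x', hS _ _ y z hx' h⟩)

/-- The finite subgames of a game, ordered by inclusion. -/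
abbrev FiniteSubgame : Type u := {S : Set X.carrier // X.IsSubgame S ∧ S.Finite}

instance : Nonempty X.FiniteSubgame := ⟨⟨∅, fun _ _ h => h.elim, Set.finite_empty⟩⟩

instance : IsDirectedOrder X.FiniteSubgame where
  directed S T := ⟨⟨S.1 ∪ T.1, fun x x' h hm => h.imp (S.2.1 x x' · hm) (T.2.1 x x' · hm),
    S.2.2.union T.2.2⟩, Set.subset_union_left, Set.subset_union_right⟩

/-- The diagram of finite subgames of a game and their inclusions. -/
def finiteSubgames : X.FiniteSubgame ⥤ Game.{u} where
  obj S := X.ofSubgame S.1 S.2.1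
  map {S T} f := subgameLift T.2.1 (X.subgameι S.1 S.2.1) fun x => leOfHom f x.2

/-- The inclusions of the finite subgames into a game. -/
def finiteSubgamesCocone : Cocone X.finiteSubgames where
  pt := X
  ι := { app := fun S => X.subgameι S.1 S.2.1 }

/-- A game is the colimit of its finite subgames. -/
noncomputable def finiteSubgamesCoconeIsColimit : IsColimit X.finiteSubgamesCocone :=
  isColimitOfMapCocone <| Types.FilteredColimit.isColimitOf' _ _
    (fun x => by
      obtain ⟨S, hS, hf, hx⟩ := X.exists_finite_subgame x
      exact ⟨⟨S, hS, hf⟩, ⟨x, hx⟩, rfl⟩)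
    (fun S _ _ h => ⟨S, 𝟙 S, congrArg _ (Subtype.ext h)⟩)

end FiniteSubgames

/-! ### Local finite presentability -/

section LocallyFinitelyPresentable

/-- The game on a type `C` transported from a game along a bijection of its states with `C`. -/
def transport (X : Game.{u}) {C : Type u} (e : X.carrier ≃ C) : Game.{u} where
  carrier := C
  move a b := X.move (e.symm a) (e.symm b)
  finite_options a := (X.finite_options (e.symm a)).preimage e.symm.injective.injOn
  finite_time := fun ⟨p, hp⟩ => X.finite_time ⟨fun n => e.symm (p n), hp⟩

theorem nonempty_iso_transport (X : Game.{u}) {C : Type u} (e : X.carrier ≃ C) :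
    Nonempty (X ≅ X.transport e) := by
  let f : X ⟶ X.transport e :=
    { toFun := e
      map_move := fun {x x'} h => by simpa [transport] using h
      lift_move := fun {x y} h => ⟨e.symm y, by simpa [transport] using h, e.apply_symm_apply y⟩ }
  have := isIso_of_bijective f e.bijective
  exact ⟨asIso f⟩

/-- The property of having finitely many states. -/
def isFinite : ObjectProperty Game.{u} := fun X => Finite X.carrier

/-- The game on `n` states given by a move relation without infinite paths. -/
def ofFin (p : Σ n : ℕ, {m : ULift.{u} (Fin n) → ULift.{u} (Fin n) → Prop //
    ¬ ∃ p : ℕ → ULift.{u} (Fin n), ∀ k, m (p k) (p (k + 1))}) : Game.{u} where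
  carrier := ULift.{u} (Fin p.1)
  move := p.2.1
  finite_options _ := Set.toFinite _
  finite_time := p.2.2

instance : ObjectProperty.EssentiallySmall.{u} isFinite.{u} where
  exists_small_le' := ⟨.ofObj ofFin, inferInstance, fun X hX => by
    have : Finite X.carrier := hX
    obtain ⟨n, ⟨e⟩⟩ := Finite.exists_equiv_fin X.carrier
    let Y := X.transport (e.trans Equiv.ulift.symm)
    exact ⟨Y, ObjectProperty.ofObj_apply ofFin ⟨n, Y.move, Y.finite_time⟩,
      X.nonempty_iso_transport _⟩⟩

attribute [local instance] Cardinal.fact_isRegular_aleph0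

theorem isCardinalFilteredGenerator_isFinite :
    isFinite.{u}.IsCardinalFilteredGenerator Cardinal.aleph0.{u} where
  le_isCardinalPresentable X hX :=
    have : Finite X.carrier := hX
    isFinitelyPresentable_of_finite X
  exists_colimitsOfShape X :=
    ⟨X.FiniteSubgame, inferInstance, (isCardinalFiltered_aleph0_iff _).2 inferInstance,
      ⟨{ diag := X.finiteSubgames
         ι := X.finiteSubgamesCocone.ι
         isColimit := X.finiteSubgamesCoconeIsColimit
         prop_diag_obj := fun S => S.2.2.to_subtype }⟩⟩

instance isLocallyFinitelyPresentable : IsLocallyFinitelyPresentable.{u} Game.{u} where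
  toHasCardinalFilteredGenerator :=
    isCardinalFilteredGenerator_isFinite.{u}.hasCardinalFilteredGenerator

/-- A finitely presentable game is a retract of a finite one, hence finite. -/
theorem isFinitelyPresentable_iff (X : Game.{u}) :
    IsFinitelyPresentable.{u} X ↔ Finite X.carrier := by
  refine ⟨fun h => ?_, fun _ => isFinitelyPresentable_of_finite X⟩
  have h' : isCardinalPresentable Game.{u} Cardinal.aleph0.{u} X := h
  rw [isCardinalFilteredGenerator_isFinite.isPresentable_eq_retractClosure] at h'
  obtain ⟨Y, hY, ⟨r⟩⟩ := h'
  have : Finite Y.carrier := hY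
  exact Finite.of_injective r.i.toFun (Function.LeftInverse.injective (congr_toFun r.retract))

end LocallyFinitelyPresentable

/-! ### Monomorphisms -/

/-- The kernel pair, in `Set`, of a game morphism, with simultaneous moves in both components. -/
def kernelPair {X Y : Game.{u}} (f : X ⟶ Y) : Game.{u} where
  carrier := {p : X.carrier × X.carrier // f.toFun p.1 = f.toFun p.2}
  move p q := X.move p.1.1 q.1.1 ∧ X.move p.1.2 q.1.2
  finite_options p :=
    ((X.finite_options p.1.1).prod (X.finite_options p.1.2)).preimage
      Subtype.val_injective.injOn
  finite_time := fun ⟨p, hp⟩ => X.finite_time ⟨fun n => (p n).1.1, fun n => (hp n).1⟩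

/-- Monomorphisms are injective: the projections of the kernel pair lift moves, since the morphism
itself does, so they are game morphisms, and they agree after composition with the morphism. -/
theorem injective_of_mono {X Y : Game.{u}} (f : X ⟶ Y) [Mono f] :
    Function.Injective f.toFun := by
  let p₁ : kernelPair f ⟶ X :=
    { toFun := fun p => p.1.1
      map_move := And.left
      lift_move := fun {p x} h => by
        have h' := f.map_move h
        rw [p.2] at h'
        obtain ⟨y, hy, e⟩ := f.lift_move h'
        exact ⟨⟨(x, y), e.symm⟩, ⟨h, hy⟩, rfl⟩ }
  let p₂ : kernelPair f ⟶ X :=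
    { toFun := fun p => p.1.2
      map_move := And.right
      lift_move := fun {p x} h => by
        have h' := f.map_move h
        rw [← p.2] at h'
        obtain ⟨y, hy, e⟩ := f.lift_move h'
        exact ⟨⟨(y, x), e⟩, ⟨hy, h⟩, rfl⟩ }
  have h : p₁ = p₂ := (cancel_mono f).1 (hom_ext fun p => p.2)
  exact fun x y e => congr_toFun h ⟨(x, y), e⟩

/-! ### The subobject classifier -/

section Classifier

variable {X Y S : Game.{u}}

/-- Morphisms to `Ω` are determined by the labels of their values. -/
theorem hom_ext_omegaLabel {g g' : X ⟶ omega.{u}}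
    (h : ∀ x, omegaLabel (g.toFun x) = omegaLabel (g'.toFun x)) : g = g' := by
  have := hom_ext_label (g := g ≫ subgameι _ _ isSubgame_truthClosed)
    (g' := g' ≫ subgameι _ _ isSubgame_truthClosed) h
  exact hom_ext fun x => Subtype.ext (congr_toFun this x)

theorem truthValue_eq_of_eq_top_iff {a b : TruthValue.{u}}
    (h : a = TruthValue.top ↔ b = TruthValue.top) : a = b := by
  cases a <;> cases b <;> simp_all

open Classical in
/-- The labeling of states by their membership in a set. -/
noncomputable def truthLabel (T : Set X.carrier) (x : X.carrier) : TruthValue.{u} :=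
  if x ∈ T then .top else .bot

theorem truthLabel_eq_top_iff {T : Set X.carrier} {x : X.carrier} :
    truthLabel T x = TruthValue.top ↔ x ∈ T := by
  unfold truthLabel
  split_ifs with h <;> simp [h]

theorem truthClosed_unfold {T : Set X.carrier} (hT : X.IsSubgame T) (x : X.carrier) :
    TruthClosed (X.unfold (truthLabel T) x) := by
  induction x using move_induction with
  | h x ih =>
    refine .intro _ ?_ ?_ <;> rw [elements_unfold]
    · rw [label_unfold, truthLabel_eq_top_iff]
      rintro hx _ ⟨x', hx', rfl⟩
      rw [label_unfold, truthLabel_eq_top_iff]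
      exact hT x x' hx hx'
    · rintro _ ⟨x', hx', rfl⟩
      exact ih x' hx'

/-- The characteristic morphism of a subgame. -/
noncomputable def char {T : Set X.carrier} (hT : X.IsSubgame T) : X ⟶ omega.{u} :=
  subgameLift isSubgame_truthClosed (X.unfoldHom (truthLabel T)) (truthClosed_unfold hT)

theorem omegaLabel_char {T : Set X.carrier} (hT : X.IsSubgame T) (x : X.carrier) :
    omegaLabel ((char hT).toFun x) = TruthValue.top ↔ x ∈ T := by
  rw [← truthLabel_eq_top_iff]
  exact iff_of_eq (congrArg (· = TruthValue.top) (label_unfold _ x))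

theorem isSubgame_omegaLabel_top :
    omega.{u}.IsSubgame {A | omegaLabel A = TruthValue.top} := by
  rintro ⟨_, ⟨A, h, _⟩⟩ ⟨B, _⟩ hA hB
  exact h hA B hB

/-- The preimage of the states of `Ω` labeled by `⊤` under a morphism is a subgame. -/
theorem isSubgame_preimage_top (f : X ⟶ omega.{u}) :
    X.IsSubgame {x | omegaLabel (f.toFun x) = TruthValue.top} :=
  fun _ _ hx h => isSubgame_omegaLabel_top _ _ hx (f.map_move h)

/-- The game of true states of `Ω`: the domain of the truth morphism, a terminal game. -/
noncomputable def omegaTop : Game.{u} := omega.{u}.ofSubgame _ isSubgame_omegaLabel_top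

/-- The inclusion of the true states of `Ω`. -/
noncomputable def truth : omegaTop.{u} ⟶ omega.{u} := subgameι _ _ isSubgame_omegaLabel_top

theorem hom_ext_omegaTop (f g : X ⟶ omegaTop.{u}) : f = g := by
  have h : f ≫ truth = g ≫ truth :=
    hom_ext_omegaLabel fun x => (f.toFun x).2.trans (g.toFun x).2.symm
  exact hom_ext fun x => Subtype.ext (congr_toFun h x)

/-- The morphism to the true states of `Ω` that labels every state by `⊤`. -/
noncomputable def toOmegaTop (X : Game.{u}) : X ⟶ omegaTop.{u} :=
  subgameLift isSubgame_omegaLabel_top (char (T := Set.univ) fun _ _ _ _ => trivial)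
    fun x => (omegaLabel_char _ x).2 trivial

/-- The lift along an injective morphism of a morphism whose values lie in its image. -/
theorem exists_lift {m : S ⟶ X} (hm : Function.Injective m.toFun) (f : Y ⟶ X)
    (hf : ∀ y, ∃ s, m.toFun s = f.toFun y) : ∃ g : Y ⟶ S, g ≫ m = f := by
  choose g hg using hf
  refine ⟨{ toFun := g, map_move := ?_, lift_move := ?_ }, hom_ext hg⟩
  · intro y y' h
    have h1 := f.map_move h
    rw [← hg] at h1
    obtain ⟨s, hs, e⟩ := m.lift_move h1
    rwa [← hm (e.trans (hg y').symm)]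
  · intro y s h
    have h1 := m.map_move h
    rw [hg] at h1
    obtain ⟨y', hy', e⟩ := f.lift_move h1
    exact ⟨y', hy', hm ((hg y').trans e)⟩

theorem isPullback_char (m : S ⟶ X) [Mono m] :
    IsPullback m (toOmegaTop S) (char (isSubgame_range m)) truth := by
  have w : m ≫ char (isSubgame_range m) = toOmegaTop S ≫ truth :=
    hom_ext_omegaLabel fun s => ((omegaLabel_char (isSubgame_range m) _).2 ⟨s, rfl⟩).trans
      ((toOmegaTop S).toFun s).2.symm
  have key : ∀ s : PullbackCone (char (isSubgame_range m)) truth,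
      ∃ g : s.pt ⟶ S, g ≫ m = s.fst := fun s =>
    exists_lift (injective_of_mono m) s.fst fun y => by
      refine (omegaLabel_char (isSubgame_range m) _).1 ?_
      exact (congrArg omegaLabel (congr_toFun s.condition y)).trans (s.snd.toFun y).2
  choose l hl using key
  exact ⟨⟨w⟩, ⟨PullbackCone.IsLimit.mk w l hl (fun _ => hom_ext_omegaTop _ _)
    fun s _ h _ => (cancel_mono m).1 (h.trans (hl s).symm)⟩⟩

/-- A morphism to `Ω` along which the truth morphism pulls back to `m` takes the label `⊤` exactly
on the image of `m`: the subgame on which it takes the label `⊤` factors through the pullback. -/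
theorem omegaLabel_eq_top_iff_of_isPullback {m : S ⟶ X} {χ₀ : S ⟶ omegaTop.{u}}
    {χ : X ⟶ omega.{u}} (h : IsPullback m χ₀ χ truth) (x : X.carrier) :
    omegaLabel (χ.toFun x) = TruthValue.top ↔ ∃ s, m.toFun s = x := by
  constructor
  · intro hx
    let T := X.ofSubgame _ (isSubgame_preimage_top χ)
    have e : X.subgameι _ (isSubgame_preimage_top χ) ≫ χ = toOmegaTop T ≫ truth :=
      hom_ext_omegaLabel fun y => y.2.trans ((toOmegaTop T).toFun y).2.symm
    exact ⟨(h.lift _ _ e).toFun ⟨x, hx⟩, congr_toFun (h.lift_fst _ _ e) ⟨x, hx⟩⟩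
  · rintro ⟨s, rfl⟩
    exact (congrArg omegaLabel (congr_toFun h.w s)).trans (χ₀.toFun s).2

/-- The game `Ω` as a subobject classifier. -/
noncomputable def classifier : Subobject.Classifier Game.{u} where
  Ω₀ := omegaTop
  Ω := omega
  truth := truth
  mono_truth := ⟨fun _ _ _ => hom_ext_omegaTop _ _⟩
  χ₀ := toOmegaTop
  χ m _ := char (isSubgame_range m)
  isPullback m _ := isPullback_char m
  uniq m _ _ _ h := hom_ext_omegaLabel fun x => truthValue_eq_of_eq_top_iff <|
    (omegaLabel_eq_top_iff_of_isPullback h x).trans (omegaLabel_char (isSubgame_range m) x).symm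

end Classifier

end Game

theorem mainTheorem4 :
    -- `Game` is locally finitely presentable, complete and cocomplete
    IsLocallyFinitelyPresentable.{u} Game.{u} ∧
    HasLimitsOfSize.{u, u} Game.{u} ∧ HasColimitsOfSize.{u, u} Game.{u} ∧
    -- the finitely presentable objects are exactly the finite games
    (∀ X : Game.{u}, IsFinitelyPresentable.{u} X ↔ Finite X.carrier) ∧
    -- `U` is comonadic, and preserves, reflects and strictly creates small colimits
    Nonempty (ComonadicLeftAdjoint Game.U.{u}) ∧
    PreservesColimitsOfSize.{u, u} Game.U.{u} ∧ ReflectsColimitsOfSize.{u, u} Game.U.{u} ∧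
    StrictlyCreatesColimits Game.U.{u} ∧
    -- `Ω` is a subobject classifier; the characteristic map of `m : S ⟶ X` sends `x` to a state
    -- of `Ω` labeled by `⊤` exactly when `x` lies in the image of `m`
    (∃ (c : Subobject.Classifier Game.{u}) (e : c.Ω = Game.omega.{u}),
      ∀ (S X : Game.{u}) (m : S ⟶ X) [Mono m] (x : X.carrier),
        Game.omegaLabel ((c.χ m ≫ eqToHom e).toFun x) = TruthValue.top ↔
          ∃ s : S.carrier, m.toFun s = x) := by
  refine ⟨inferInstance, inferInstance, inferInstance, Game.isFinitelyPresentable_iff,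
    ⟨inferInstance⟩, inferInstance, inferInstance, Game.strictlyCreatesColimits_U,
    Game.classifier, rfl, fun S X m _ x => ?_⟩
  -- Composition with `eqToHom rfl` does not change the underlying function, by definition.
  exact Game.omegaLabel_char (Game.isSubgame_range m) x
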